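/- Let $(\Omega,\mathcal F,\mathbb P)$ be a probability space with a filtration $\mathcal F_0\subseteq\mathcal F_1\subseteq\cdots\subseteq\mathcal F$. Let $(X_t)_{t\ge1}$ be a real martingale difference sequence adapted to $(\mathcal F_t)$, i.e. $X_t$ is integrable and $\mathcal F_t$-measurable with $\mathbb E[X_t\mid\mathcal F_{t-1}]=0$ almost surely. Let $(C_t)_{t\ge1}$ and $(\hat X_t)_{t\ge1}$ be real random sequences such that $C_t$ and $\hat X_t$ are $\mathcal F_{t-1}$-measurable, and suppose that, for every $t\ge1$, $|X_t|\le C_t$ and $|\hat X_t|\le C_t$ almost surely. Let $S$ be the set of all nonnegative nondecreasing real sequences $y=(y_i)_{i\ge1}$, and put $\theta_{t,\delta}=\log\frac{60\log(6t)}{\delta}$ (natural logarithms). Then for all $\delta\in(0,1)$, $c>0$ and $T\in\mathbb N$, $$\mathbb P\Big(\exists\,1\le t\le T,\ \exists\,y\in S \text{ with } y_t>0:\ \Big|\sum_{i=1}^t y_iX_i\Big|\ge 8\,y_t\sqrt{\theta_{t,\delta}\sum_{i=1}^t(X_i-\hat X_i)^2+c^2\theta_{t,\delta}^2}\Big)\le\delta+\mathbb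 P\big(\exists\,1\le t\le T:\ C_t>c\big).$$ In particular, since both sides of the inequality vanish when $y_t=0$, outside this event one has $\big|\sum_{i=1}^t y_iX_i\big|\le 8y_t\sqrt{\theta_{t,\delta}\sum_{i=1}^t(X_i-\hat X_i)^2+c^2\theta_{t,\delta}^2}$ simultaneously for all $1\le t\le T$ and all $y\in S$. -/

import Mathlib

open MeasureTheory

/-- The time-uniform log factor `θ_{t,δ} = log (60 log (6 t) / δ)`, used for integers `t ≥ 1`. -/
noncomputable def timeUniformLog (t : ℕ) (δ : ℝ) : ℝ :=
  Real.log (60 * Real.log (6 * (t : ℝ)) / δ)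

/-- The real process `X 1, X 2, …` is a martingale difference sequence adapted to
`ℱ 0 ⊆ ℱ 1 ⊆ …`: `X t` is `ℱ t`-measurable and integrable, and `E[X t | ℱ (t - 1)] = 0` a.s.,
for every `t ≥ 1`. The value `X 0` plays no role. -/
structure IsMartingaleDifference {Ω : Type*} {m0 : MeasurableSpace Ω}
    (X : ℕ → Ω → ℝ) (ℱ : Filtration ℕ m0) (μ : Measure Ω) : Prop where
  measurable : ∀ t, Measurable[ℱ (t + 1)] (X (t + 1))
  integrable : ∀ t, Integrable (X (t + 1)) μ
  condExp_eq_zero : ∀ t, μ[X (t + 1) | ℱ t] =ᵐ[μ] 0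

/-- Nonnegative nondecreasing real sequences `y 1, y 2, …` (the value `y 0` plays no role). -/
def nonnegNondecSeq : Set (ℕ → ℝ) :=
  {y | (∀ i, 1 ≤ i → 0 ≤ y i) ∧ MonotoneOn y (Set.Ici 1)}

/-! By Abel summation the supremum over `y` costs only a factor `2 * y t`: a large weighted sum
forces some partial sum of the `X i`, at a time `s ≤ t`, to exceed the boundary at `t`, which
dominates the one at `s`. The predictable truncation `X i / c` on `{C i ≤ c}` keeps the martingale
difference property and changes nothing unless some `C t > c`. For increments `x i` and predictions
`h i` bounded by `1`, with `S = ∑ x i` and `V = ∑ (x i - h i) ^ 2`, the process `exp (l S - l² V /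
(2 (1 - 2 l)))` is a supermartingale (`supermartingale_expProcess`). Ville's inequality makes `S`
cross a line in `V` with probability at most `exp (-L)`. One line per scale `4 ^ k ≤ V < 4 ^ (k +
1)`, with levels `L` whose failure probabilities are summable, yields the square-root boundary
(`exists_stitchLog_le`). -/

/-! ### Abel summation -/

open Finset in
/-- Abel summation: weighting by a nonnegative nondecreasing sequence at most doubles the largest
partial sum. -/
theorem exists_le_abs_sum_of_nonnegNondecSeq {y x : ℕ → ℝ} (hy : y ∈ nonnegNondecSeq) {t : ℕ}
    (ht : 1 ≤ t) (hyt : 0 < y t) {B : ℝ} (hB : 2 * y t * B ≤ |∑ i ∈ Icc 1 t, y i * x i|) :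
    ∃ s, 1 ≤ s ∧ s ≤ t ∧ B ≤ |∑ i ∈ Icc 1 s, x i| := by
  by_contra! hlt
  obtain ⟨hy0, hmono⟩ := hy
  -- The difference is a combination of the partial sums before `n` with weights `y (i + 1) - y i ≥
  -- 0`, of total `y n - y 1`.
  have key : ∀ n, 1 ≤ n → n ≤ t →
      |y n * ∑ i ∈ Icc 1 n, x i - ∑ i ∈ Icc 1 n, y i * x i| ≤ (y n - y 1) * B := by
    intro n hn
    induction n, hn using Nat.le_induction with
    | base => simp
    | succ n hn ih =>
      intro hnt
      have h1 := ih (by omega)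
      have h2 := hlt n hn (by omega)
      have h3 : y n ≤ y (n + 1) :=
        hmono (Set.mem_Ici.2 hn) (Set.mem_Ici.2 (by omega)) (Nat.le_succ n)
      rw [Finset.sum_Icc_succ_top (by omega), Finset.sum_Icc_succ_top (by omega)]
      have h4 : y (n + 1) * (∑ i ∈ Icc 1 n, x i + x (n + 1))
          - (∑ i ∈ Icc 1 n, y i * x i + y (n + 1) * x (n + 1))
          = (y (n + 1) - y n) * ∑ i ∈ Icc 1 n, x i
            + (y n * ∑ i ∈ Icc 1 n, x i - ∑ i ∈ Icc 1 n, y i * x i) := by ring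
      rw [h4]
      refine (abs_add_le _ _).trans ?_
      rw [abs_mul, abs_of_nonneg (sub_nonneg.2 h3)]
      have h5 := mul_le_mul_of_nonneg_left h2.le (sub_nonneg.2 h3)
      linarith
  have h1 := key t ht le_rfl
  have h2 := hlt t ht le_rfl
  have h3 := hy0 1 le_rfl
  have hBpos : 0 < B := (abs_nonneg _).trans_lt h2
  have h4 : |y t * ∑ i ∈ Icc 1 t, x i| < y t * B := by
    rw [abs_mul, abs_of_pos hyt]
    exact mul_lt_mul_of_pos_left h2 hyt
  have h5 := abs_sub_abs_le_abs_sub (∑ i ∈ Icc 1 t, y i * x i) (y t * ∑ i ∈ Icc 1 t, x i)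
  rw [abs_sub_comm] at h5
  nlinarith [mul_nonneg h3 hBpos.le]

/-! ### Exponential supermartingale and Ville's inequality -/

/-- `log (1 + u) ≥ u - u² / (2 (1 - s))` for `u ≥ -s`, in exponential form. -/
theorem exp_sub_sq_div_le {u s : ℝ} (hs0 : 0 ≤ s) (hs1 : s < 1) (hu : -s ≤ u) :
    Real.exp (u - u ^ 2 / (2 * (1 - s))) ≤ 1 + u := by
  have hu1 : 0 < 1 + u := by linarith
  rw [← Real.le_log_iff_exp_le hu1]
  rcases le_total 0 u with h0 | h0
  · refine le_trans ?_ (Real.le_log_one_add_of_nonneg h0)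
    have h1 : u ^ 2 / 2 ≤ u ^ 2 / (2 * (1 - s)) :=
      div_le_div_of_nonneg_left (sq_nonneg u) (by linarith) (by linarith)
    have h2 : u - u ^ 2 / 2 ≤ 2 * u / (u + 2) := by
      rw [le_div_iff₀ (by linarith)]
      nlinarith [pow_nonneg h0 3]
    linarith
  · have h1 : u ^ 2 / (2 * (1 + u)) ≤ u ^ 2 / (2 * (1 - s)) :=
      div_le_div_of_nonneg_left (sq_nonneg u) (by linarith) (by linarith)
    have h2 : 0 ≤ -Real.log (1 + u) := by
      have := Real.log_nonpos hu1.le (by linarith)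
      linarith
    -- With `a = -log (1 + u)`, `a ≤ sinh a` reads `log (1 + u) ≥ u - u² / (2 (1 + u))`.
    have h3 := Real.self_le_sinh_iff.2 h2
    rw [Real.sinh_eq, neg_neg, Real.exp_neg, Real.exp_log hu1] at h3
    have h4 : u - u ^ 2 / (2 * (1 + u)) = -(((1 + u)⁻¹ - (1 + u)) / 2) := by
      field_simp
      ring
    linarith

/-- **Ville's inequality** over a finite horizon. -/
theorem measure_exists_ge_le_of_supermartingale {Ω : Type*} {m0 : MeasurableSpace Ω}
    {μ : Measure Ω} [IsProbabilityMeasure μ] {ℱ : Filtration ℕ m0} {M : ℕ → Ω → ℝ}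
    (hM : Supermartingale M ℱ μ) (hM0 : ∀ n ω, 0 ≤ M n ω) {a : ℝ} (ha : 0 < a) (n : ℕ) :
    μ {ω | ∃ s ≤ n, a ≤ M s ω} ≤ ENNReal.ofReal ((∫ ω, M 0 ω ∂μ) / a) := by
  set A : ℕ → Set Ω := fun n => {ω | ∀ s ≤ n, M s ω < a} with hA
  have hAm : ∀ n, MeasurableSet[ℱ n] (A n) := by
    intro n
    have : A n = ⋂ s ∈ Set.Iic n, {ω | M s ω < a} := by
      ext ω
      simp [hA]
    rw [this]
    refine MeasurableSet.biInter (Set.to_countable _) fun s hs => ?_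
    exact ℱ.mono hs _ ((hM.stronglyMeasurable s).measurable measurableSet_Iio)
  have hAm0 : ∀ n, MeasurableSet (A n) := fun n => ℱ.le n _ (hAm n)
  have hAsucc : ∀ n, A (n + 1) ⊆ A n := fun n ω h s hs => h s (by omega)
  have hge : ∀ (n : ℕ) (s : Set Ω), MeasurableSet s → (∀ ω ∈ s, a ≤ M n ω) →
      a * μ.real s ≤ ∫ ω in s, M n ω ∂μ := by
    intro n s hs h
    have := setIntegral_mono_on (integrableOn_const (μ := μ) (s := s) (C := a))
      (hM.integrable n).integrableOn hs h
    rwa [setIntegral_const, smul_eq_mul, mul_comm] at this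
  -- Optional stopping by hand: paths that have crossed are charged `a`, the others their current
  -- value.
  have key : ∀ n, a * μ.real (A n)ᶜ + ∫ ω in A n, M n ω ∂μ ≤ ∫ ω, M 0 ω ∂μ := by
    intro n
    induction n with
    | zero =>
      rw [← integral_add_compl (hAm0 0) (hM.integrable 0), add_comm]
      refine add_le_add le_rfl (hge 0 _ (hAm0 0).compl fun ω h => ?_)
      by_contra! hlt
      exact h fun s hs => by rwa [Nat.le_zero.1 hs]
    | succ n ih =>
      have h1 := hM.setIntegral_le (Nat.le_succ n) (hAm n)
      have h2 : ∫ ω in A n, M (n + 1) ω ∂μ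
          = ∫ ω in A (n + 1), M (n + 1) ω ∂μ + ∫ ω in A n \ A (n + 1), M (n + 1) ω ∂μ := by
        rw [← setIntegral_union Set.disjoint_sdiff_right ((hAm0 n).diff (hAm0 (n + 1)))
          (hM.integrable _).integrableOn (hM.integrable _).integrableOn,
          Set.union_sdiff_cancel (hAsucc n)]
      have h3 := hge (n + 1) (A n \ A (n + 1)) ((hAm0 n).diff (hAm0 (n + 1))) (by
        rintro ω ⟨h, h'⟩
        by_contra! hlt
        refine h' fun s hs => ?_
        rcases Nat.lt_or_ge n s with hns | hns
        · rwa [show s = n + 1 by omega]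
        · exact h s hns)
      have h4 : μ.real (A (n + 1))ᶜ = μ.real (A n)ᶜ + μ.real (A n \ A (n + 1)) := by
        have := measureReal_sdiff (μ := μ) (hAsucc n) (hAm0 (n + 1))
        rw [this, probReal_compl_eq_one_sub (hAm0 _), probReal_compl_eq_one_sub (hAm0 _)]
        ring
      rw [h4]
      simp only [Nat.succ_eq_add_one] at h1
      linarith
  have h1 : {ω | ∃ s ≤ n, a ≤ M s ω} = (A n)ᶜ := by
    ext ω
    simp [hA]
  have h2 : 0 ≤ ∫ ω in A n, M n ω ∂μ := setIntegral_nonneg (hAm0 n) fun ω _ => hM0 n ω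
  rw [h1, ← ofReal_measureReal]
  refine ENNReal.ofReal_le_ofReal ?_
  rw [le_div_iff₀ ha]
  linarith [key n]

/-- The self-normalized exponential process. -/
noncomputable def expProcess {Ω : Type*} (x h : ℕ → Ω → ℝ) (l : ℝ) (n : ℕ) (ω : Ω) : ℝ :=
  Real.exp (l * ∑ i ∈ Finset.range n, x i ω
    - l ^ 2 / (2 * (1 - 2 * l)) * ∑ i ∈ Finset.range n, (x i ω - h i ω) ^ 2)

section Increments

variable {Ω : Type*} {m0 : MeasurableSpace Ω} {μ : Measure Ω} [IsProbabilityMeasure μ]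
  {ℱ : Filtration ℕ m0} {x h : ℕ → Ω → ℝ}

/-- With `u = l (x n - h n) ≥ -2 l`, `exp_sub_sq_div_le` at `s = 2 l` replaces the new factor by
`exp (l h n) (1 + u)`. This is affine in `x n`, so its conditional mean is `exp (l h n) (1 - l h n)
≤ 1`. -/
theorem supermartingale_expProcess (hx : ∀ i, Measurable[ℱ (i + 1)] (x i))
    (hx0 : ∀ i, μ[x i | ℱ i] =ᵐ[μ] 0) (hx1 : ∀ i, ∀ᵐ ω ∂μ, |x i ω| ≤ 1)
    (hh : ∀ i, Measurable[ℱ i] (h i)) (hh1 : ∀ i, ∀ᵐ ω ∂μ, |h i ω| ≤ 1)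
    {l : ℝ} (hl0 : 0 ≤ l) (hl1 : l < 1 / 2) :
    Supermartingale (expProcess x h l) ℱ μ := by
  have hphi : 0 ≤ l ^ 2 / (2 * (1 - 2 * l)) := div_nonneg (sq_nonneg l) (by linarith)
  have hmeas : ∀ n, Measurable[ℱ n] (expProcess x h l n) := by
    intro n
    have h1 : ∀ i ∈ Finset.range n, Measurable[ℱ n] (x i) := fun i hi =>
      (hx i).mono (ℱ.mono (by have := Finset.mem_range.1 hi; omega)) le_rfl
    have h2 : ∀ i ∈ Finset.range n, Measurable[ℱ n] (h i) := fun i hi =>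
      (hh i).mono (ℱ.mono (by have := Finset.mem_range.1 hi; omega)) le_rfl
    exact ((((Finset.measurable_fun_sum _ h1).const_mul l).sub
      ((Finset.measurable_fun_sum _ fun i hi =>
        ((h1 i hi).sub (h2 i hi)).pow_const 2).const_mul _))).exp
  have hpos : ∀ n ω, 0 ≤ expProcess x h l n ω := fun n ω => Real.exp_nonneg _
  have hint_of_bdd : ∀ (f : Ω → ℝ) (b : ℝ), Measurable f → (∀ᵐ ω ∂μ, |f ω| ≤ b) →
      Integrable f μ := fun f b hf hb => Integrable.of_bound hf.aestronglyMeasurable b hb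
  have hbdd : ∀ n, ∀ᵐ ω ∂μ, expProcess x h l n ω ≤ Real.exp (l * n) := by
    intro n
    filter_upwards [ae_all_iff.2 hx1] with ω hω
    refine Real.exp_le_exp.2 ?_
    have h1 : ∑ i ∈ Finset.range n, x i ω ≤ n := by
      have := Finset.sum_le_card_nsmul (Finset.range n) (fun i => x i ω) 1
        fun i _ => (le_abs_self _).trans (hω i)
      simpa using this
    have h2 : 0 ≤ ∑ i ∈ Finset.range n, (x i ω - h i ω) ^ 2 :=
      Finset.sum_nonneg fun i _ => sq_nonneg _
    nlinarith [mul_le_mul_of_nonneg_left h1 hl0, mul_nonneg hphi h2]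
  have hint : ∀ n, Integrable (expProcess x h l n) μ := fun n =>
    hint_of_bdd _ (Real.exp (l * n)) ((hmeas n).mono (ℱ.le n) le_rfl) <| by
      filter_upwards [hbdd n] with ω hω
      rwa [abs_of_nonneg (hpos n ω)]
  refine supermartingale_nat (fun n => (hmeas n).stronglyMeasurable) hint fun n => ?_
  set W : Ω → ℝ := fun ω => expProcess x h l n ω * Real.exp (l * h n ω) with hW
  have hWm : Measurable[ℱ n] W := (hmeas n).mul ((hh n).const_mul l).exp
  have hWb : ∀ᵐ ω ∂μ, |W ω| ≤ Real.exp (l * n) * Real.exp l := by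
    filter_upwards [hbdd n, hh1 n] with ω h1 h2
    rw [hW, abs_of_nonneg (mul_nonneg (hpos n ω) (Real.exp_nonneg _))]
    refine mul_le_mul h1 (Real.exp_le_exp.2 ?_) (Real.exp_nonneg _) (Real.exp_nonneg _)
    nlinarith [(abs_le.1 h2).2]
  have hxm : Measurable (x n) := (hx n).mono (ℱ.le _) le_rfl
  have hxi : Integrable (x n) μ := hint_of_bdd _ 1 hxm (hx1 n)
  set D : Ω → ℝ := fun ω => W ω * (1 - l * h n ω) with hD
  set G : Ω → ℝ := fun ω => l * W ω with hG
  have hDm : Measurable[ℱ n] D := hWm.mul (((hh n).const_mul l).const_sub 1)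
  have hGm : Measurable[ℱ n] G := hWm.const_mul l
  have hDi : Integrable D μ := by
    refine hint_of_bdd _ (Real.exp (l * n) * Real.exp l * 2) (hDm.mono (ℱ.le n) le_rfl) ?_
    filter_upwards [hWb, hh1 n] with ω h1 h2
    rw [hD, abs_mul]
    refine mul_le_mul h1 ?_ (abs_nonneg _) (by positivity)
    have := abs_le.1 h2
    rw [abs_le]
    constructor <;> nlinarith
  have hGxi : Integrable (G * x n) μ := by
    refine hint_of_bdd _ (l * (Real.exp (l * n) * Real.exp l))
      ((hGm.mono (ℱ.le n) le_rfl).mul hxm) ?_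
    filter_upwards [hWb, hx1 n] with ω h1 h2
    rw [Pi.mul_apply, hG, abs_mul, abs_mul, abs_of_nonneg hl0]
    have := mul_le_mul_of_nonneg_left h1 hl0
    nlinarith [abs_nonneg (x n ω), mul_nonneg hl0 (abs_nonneg (W ω))]
  have hle : expProcess x h l (n + 1) ≤ᵐ[μ] D + G * x n := by
    filter_upwards [hx1 n, hh1 n] with ω h1 h2
    have e1 : expProcess x h l (n + 1) ω = W ω * Real.exp (l * (x n ω - h n ω)
        - (l * (x n ω - h n ω)) ^ 2 / (2 * (1 - 2 * l))) := by
      simp only [hW, expProcess, ← Real.exp_add, Finset.sum_range_succ]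
      congr 1
      ring
    have e2 : (D + G * x n) ω = W ω * (1 + l * (x n ω - h n ω)) := by
      simp only [hD, hG, Pi.add_apply, Pi.mul_apply]
      ring
    rw [e1, e2]
    refine mul_le_mul_of_nonneg_left (exp_sub_sq_div_le (by linarith) (by linarith) ?_)
      (mul_nonneg (Real.exp_nonneg _) (Real.exp_nonneg _))
    nlinarith [(abs_le.1 h1).1, (abs_le.1 h2).2]
  have hc1 := condExp_mono (m := ℱ n) (hint (n + 1)) (hDi.add hGxi) hle
  have hc2 := condExp_add hDi hGxi (ℱ n)
  have hc3 := condExp_mul_of_stronglyMeasurable_left hGm.stronglyMeasurable hGxi hxi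
  have hc4 := condExp_of_stronglyMeasurable (ℱ.le n) hDm.stronglyMeasurable hDi
  filter_upwards [hc1, hc2, hc3, hx0 n] with ω h1 h2 h3 h4
  rw [h2, Pi.add_apply, h3, Pi.mul_apply, h4, hc4] at h1
  refine h1.trans ?_
  have h5 : Real.exp (l * h n ω) * (1 - l * h n ω) ≤ 1 := by
    have e := Real.add_one_le_exp (-(l * h n ω))
    calc Real.exp (l * h n ω) * (1 - l * h n ω)
        ≤ Real.exp (l * h n ω) * Real.exp (-(l * h n ω)) :=
          mul_le_mul_of_nonneg_left (by linarith) (Real.exp_nonneg _)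
      _ = 1 := by rw [← Real.exp_add]; simp
  have h6 := mul_le_mul_of_nonneg_left h5 (Real.exp_nonneg (l * ∑ i ∈ Finset.range n, x i ω
    - l ^ 2 / (2 * (1 - 2 * l)) * ∑ i ∈ Finset.range n, (x i ω - h i ω) ^ 2))
  simp only [hD, hW, expProcess, Pi.zero_apply, mul_zero, add_zero]
  linarith

end Increments

/-! ### Stitching over variance scales -/

/-- The confidence level `log (4 (k + 2)^(3/2) / δ)` of the `k`-th variance scale. -/
noncomputable def stitchLog (δ : ℝ) (k : ℕ) : ℝ :=
  Real.log (4 * (k + 2) * √(k + 2) / δ)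

/-- The slope used for empirical variances between `4 ^ k` and `4 ^ (k + 1)`. -/
noncomputable def stitchSlope (δ : ℝ) (k : ℕ) : ℝ :=
  √(stitchLog δ k) / (2 * √(stitchLog δ k) + 2 ^ k)

theorem one_le_stitchLog {δ : ℝ} (hδ0 : 0 < δ) (hδ1 : δ < 1) (k : ℕ) : 1 ≤ stitchLog δ k := by
  have hk : (0 : ℝ) ≤ k := Nat.cast_nonneg k
  rw [stitchLog, Real.le_log_iff_exp_le (by positivity), le_div_iff₀ hδ0]
  have h1 : 1 ≤ √((k : ℝ) + 2) := Real.one_le_sqrt.2 (by linarith)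
  have h2 := Real.exp_one_lt_d9
  nlinarith [Real.exp_pos 1]

theorem stitchSlope_nonneg (δ : ℝ) (k : ℕ) : 0 ≤ stitchSlope δ k := by
  unfold stitchSlope
  positivity

theorem stitchSlope_lt (δ : ℝ) (k : ℕ) : stitchSlope δ k < 1 / 2 := by
  unfold stitchSlope
  have : (0 : ℝ) < 2 ^ k := by positivity
  rw [div_lt_iff₀ (by positivity)]
  linarith

/-- The power `3/2` is what a telescoping sum of `1 / √(k + 1)` dominates. -/
theorem exp_neg_stitchLog_le {δ : ℝ} (hδ0 : 0 < δ) (k : ℕ) :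
    Real.exp (-stitchLog δ k) ≤ δ / 2 * (1 / √((k : ℝ) + 1) - 1 / √((k : ℝ) + 2)) := by
  have hk : (0 : ℝ) ≤ k := Nat.cast_nonneg k
  rw [stitchLog, Real.exp_neg, Real.exp_log (by positivity)]
  set a := √((k : ℝ) + 1) with ha
  set b := √((k : ℝ) + 2) with hb
  have ha0 : 0 < a := Real.sqrt_pos.2 (by linarith)
  have hab : a ≤ b := Real.sqrt_le_sqrt (by linarith)
  have hb0 : 0 < b := ha0.trans_le hab
  have ha2 : a ^ 2 = k + 1 := Real.sq_sqrt (by linarith)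
  have hb2 : b ^ 2 = k + 2 := Real.sq_sqrt (by linarith)
  have h1 : 1 / a - 1 / b = 1 / (a * b * (a + b)) := by
    have h : (b - a) * (a + b) = 1 := by nlinarith
    field_simp
    linarith
  have h2 : 1 / (2 * b ^ 3) ≤ 1 / (a * b * (a + b)) := by
    refine one_div_le_one_div_of_le (by positivity) ?_
    have e1 : a * b ≤ b * b := mul_le_mul_of_nonneg_right hab hb0.le
    have e2 : a * b * (a + b) ≤ b * b * (b + b) :=
      mul_le_mul e1 (by linarith) (by positivity) (by positivity)
    nlinarith
  rw [h1, ← hb2]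
  calc (4 * b ^ 2 * b / δ)⁻¹ = δ / 2 * (1 / (2 * b ^ 3)) := by
        field_simp
        norm_num
    _ ≤ _ := mul_le_mul_of_nonneg_left h2 (by positivity)

theorem sum_exp_neg_stitchLog_le {δ : ℝ} (hδ0 : 0 < δ) (n : ℕ) :
    ∑ k ∈ Finset.range n, Real.exp (-stitchLog δ k) ≤ δ / 2 := by
  have h1 := Finset.sum_le_sum fun k (_ : k ∈ Finset.range n) => exp_neg_stitchLog_le hδ0 k
  have h2 := Finset.sum_range_sub' (fun k : ℕ => 1 / √((k : ℝ) + 1)) n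
  have h3 : ∑ k ∈ Finset.range n, δ / 2 * (1 / √((k : ℝ) + 1) - 1 / √((k : ℝ) + 2))
      = δ / 2 * (1 - 1 / √((n : ℝ) + 1)) := by
    rw [← Finset.mul_sum]
    congr 1
    simpa [add_assoc, one_add_one_eq_two] using h2
  rw [h3] at h1
  have h4 : 0 ≤ 1 / √((n : ℝ) + 1) := by positivity
  nlinarith

/-- The scale index is logarithmic in `t`, so `4 (k + 2) / δ` is below the argument of
`timeUniformLog`; the power `3/2` becomes the factor. -/
theorem stitchLog_le {δ : ℝ} (hδ0 : 0 < δ) (hδ1 : δ < 1) {t k : ℕ} (ht : 1 ≤ t)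
    (hk : (4 : ℝ) ^ k ≤ 4 * t) : stitchLog δ k ≤ 3 / 2 * timeUniformLog t δ := by
  have ht1 : (1 : ℝ) ≤ t := by exact_mod_cast ht
  have hk0 : (0 : ℝ) ≤ k := Nat.cast_nonneg k
  have hlog4 : 1 ≤ Real.log 4 := by
    rw [Real.le_log_iff_exp_le (by norm_num)]
    linarith [Real.exp_one_lt_d9]
  have h1 : ((k : ℝ) + 1) * Real.log 4 ≤ 2 * Real.log (6 * t) := by
    have e1 : ((k : ℝ) + 1) * Real.log 4 = Real.log (4 ^ (k + 1)) := by
      rw [Real.log_pow]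
      push_cast
      ring
    have e2 : 2 * Real.log (6 * t) = Real.log ((6 * t) ^ 2) := by
      rw [Real.log_pow]
      push_cast
      ring
    rw [e1, e2]
    refine Real.log_le_log (by positivity) ?_
    rw [pow_succ]
    nlinarith
  have h2 : (k : ℝ) + 1 ≤ 2 * Real.log (6 * t) := by nlinarith
  set l := Real.log (6 * t) with hl
  have hlpos : 0 < l := by linarith
  set z := 60 * l / δ with hz
  have hzge : 60 * l ≤ z := by
    rw [hz, le_div_iff₀ hδ0]
    nlinarith
  have hz0 : 0 < z := by linarith
  have e : 3 / 2 * timeUniformLog t δ = Real.log (z * √z) := by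
    rw [Real.log_mul hz0.ne' (Real.sqrt_pos.2 hz0).ne', Real.log_sqrt hz0.le, timeUniformLog]
    ring
  rw [e, stitchLog]
  refine Real.log_le_log (by positivity) ?_
  have h3 : 4 * ((k : ℝ) + 2) / δ ≤ z := by
    rw [hz]
    refine div_le_div_of_nonneg_right ?_ hδ0.le
    linarith
  have h4 : √((k : ℝ) + 2) ≤ √z := Real.sqrt_le_sqrt (by linarith)
  calc 4 * ((k : ℝ) + 2) * √((k : ℝ) + 2) / δ
      = 4 * ((k : ℝ) + 2) / δ * √((k : ℝ) + 2) := by ring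
    _ ≤ z * √z := mul_le_mul h3 h4 (by positivity) hz0.le

theorem stitchLog_zero_le {δ : ℝ} (hδ0 : 0 < δ) {t : ℕ} (ht : 1 ≤ t) :
    stitchLog δ 0 ≤ timeUniformLog t δ := by
  have ht1 : (1 : ℝ) ≤ t := by exact_mod_cast ht
  have h1 : 1 ≤ Real.log (6 * t) := by
    rw [Real.le_log_iff_exp_le (by positivity)]
    linarith [Real.exp_one_lt_d9]
  have h2 : √(2 : ℝ) ≤ 2 := by
    rw [Real.sqrt_le_left (by norm_num)]
    norm_num
  rw [stitchLog, timeUniformLog]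
  refine Real.log_le_log (by positivity) (div_le_div_of_nonneg_right ?_ hδ0.le)
  norm_num
  linarith

/-- Above the linear boundary of the `k`-th scale, the exponent of `expProcess` is at least
`stitchLog δ k`. -/
theorem stitchLog_le_of_le {δ : ℝ} (hδ0 : 0 < δ) (hδ1 : δ < 1) {k : ℕ} {v s : ℝ}
    (hs : 2 * stitchLog δ k + 2 ^ k * √(stitchLog δ k) + v * √(stitchLog δ k) / (2 * 2 ^ k) ≤ s) :
    stitchLog δ k ≤ stitchSlope δ k * s
      - stitchSlope δ k ^ 2 / (2 * (1 - 2 * stitchSlope δ k)) * v := by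
  have hL := one_le_stitchLog hδ0 hδ1 k
  have hL2 : √(stitchLog δ k) ^ 2 = stitchLog δ k := Real.sq_sqrt (by linarith)
  have hq : 0 < √(stitchLog δ k) := Real.sqrt_pos.2 (by linarith)
  unfold stitchSlope
  generalize √(stitchLog δ k) = q at *
  rw [← hL2] at hs ⊢
  have hx : (0 : ℝ) < 2 ^ k := by positivity
  generalize (2 : ℝ) ^ k = x at *
  -- For this slope `l`, the exponent is `l (s - v q / (2 x))`, and `q² / l = 2 q² + x q` is the
  -- intercept.
  have h1 : 1 - 2 * (q / (2 * q + x)) = x / (2 * q + x) := by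
    field_simp
    ring
  have h2 : (q / (2 * q + x)) ^ 2 / (2 * (x / (2 * q + x))) * v
      = q / (2 * q + x) * (v * q / (2 * x)) := by
    field_simp
  rw [h1, h2, ← mul_sub]
  have h3 : q ^ 2 = q / (2 * q + x) * (2 * q ^ 2 + x * q) := by
    field_simp
  calc q ^ 2 = q / (2 * q + x) * (2 * q ^ 2 + x * q) := h3
    _ ≤ _ := mul_le_mul_of_nonneg_left (by linarith) (by positivity)

/-- The curved boundary lies above one of the lines of the stitching. -/
theorem exists_stitchLog_le {δ : ℝ} (hδ0 : 0 < δ) (hδ1 : δ < 1) {t : ℕ} (ht : 1 ≤ t) {v s : ℝ}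
    (hv0 : 0 ≤ v) (hv : v ≤ 4 * t)
    (hs : 4 * √(timeUniformLog t δ * v + timeUniformLog t δ ^ 2) ≤ s) :
    ∃ k ≤ t, stitchLog δ k ≤ stitchSlope δ k * s
      - stitchSlope δ k ^ 2 / (2 * (1 - 2 * stitchSlope δ k)) * v := by
  have hθ : 1 ≤ timeUniformLog t δ :=
    (one_le_stitchLog hδ0 hδ1 0).trans (stitchLog_zero_le hδ0 ht)
  -- Variances below `1` use the line of scale `0`, at height at most `7/2 * stitchLog δ 0`.
  rcases le_total v 1 with h1 | h1
  · refine ⟨0, Nat.zero_le t, stitchLog_le_of_le hδ0 hδ1 ?_⟩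
    have hL := one_le_stitchLog hδ0 hδ1 0
    have hLθ := stitchLog_zero_le hδ0 ht
    have hL2 : √(stitchLog δ 0) ≤ stitchLog δ 0 := by
      rw [Real.sqrt_le_left (by linarith)]
      nlinarith
    have h2 : timeUniformLog t δ ≤ √(timeUniformLog t δ * v + timeUniformLog t δ ^ 2) :=
      Real.le_sqrt_of_sq_le (by nlinarith)
    have h3 : v * √(stitchLog δ 0) ≤ √(stitchLog δ 0) := by
      nlinarith [Real.sqrt_nonneg (stitchLog δ 0)]
    norm_num
    linarith
  · obtain ⟨k, hk1, hk2⟩ := exists_nat_pow_near h1 (show (1 : ℝ) < 4 by norm_num)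
    have hkt : (4 : ℝ) ^ k ≤ 4 * t := hk1.trans hv
    refine ⟨k, ?_, stitchLog_le_of_le hδ0 hδ1 ?_⟩
    · by_contra! hlt
      have e1 : (4 : ℕ) ^ (t + 1) ≤ 4 * t := by
        have : (4 : ℝ) ^ (t + 1) ≤ 4 * t :=
          (pow_le_pow_right₀ (by norm_num) (by omega)).trans hkt
        exact_mod_cast this
      have e2 : t < 4 ^ t := Nat.lt_pow_self (by norm_num)
      rw [pow_succ] at e1
      omega
    · refine le_trans ?_ hs
      have hL := one_le_stitchLog hδ0 hδ1 k
      have hLθ := stitchLog_le hδ0 hδ1 ht hkt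
      generalize stitchLog δ k = L at *
      generalize timeUniformLog t δ = θ at *
      have hx : (0 : ℝ) < 2 ^ k := by positivity
      have hx2 : (4 : ℝ) ^ k = (2 ^ k) ^ 2 := by
        rw [← pow_mul, mul_comm, pow_mul]
        norm_num
      rw [pow_succ, hx2] at hk2
      rw [hx2] at hk1
      generalize (2 : ℝ) ^ k = x at *
      obtain ⟨w, hw0, rfl⟩ : ∃ w, 0 ≤ w ∧ v = w ^ 2 :=
        ⟨√v, Real.sqrt_nonneg v, (Real.sq_sqrt hv0).symm⟩
      obtain ⟨q, hq0, rfl⟩ : ∃ q, 0 ≤ q ∧ L = q ^ 2 :=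
        ⟨√L, Real.sqrt_nonneg L, (Real.sq_sqrt (by linarith)).symm⟩
      rw [Real.sqrt_sq hq0]
      have hxw : x ≤ w := le_of_sq_le_sq hk1 hw0
      have hwx : w ≤ 2 * x := le_of_sq_le_sq (by nlinarith) (by linarith)
      -- This is `(w - x) (w - 2 x) ≤ 0` divided by `2 x`.
      have e1 : x + w ^ 2 / (2 * x) ≤ 3 / 2 * w := by
        have : w ^ 2 / (2 * x) ≤ 3 / 2 * w - x := by
          rw [div_le_iff₀ (by positivity)]
          nlinarith
        linarith
      have e2 : 2 * q ^ 2 + x * q + w ^ 2 * q / (2 * x) ≤ 2 * q ^ 2 + 3 / 2 * w * q := by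
        have := mul_le_mul_of_nonneg_right e1 hq0
        calc 2 * q ^ 2 + x * q + w ^ 2 * q / (2 * x)
            = 2 * q ^ 2 + (x + w ^ 2 / (2 * x)) * q := by ring
          _ ≤ _ := by linarith
      refine e2.trans ?_
      have e3 : (2 * q ^ 2 + 3 / 2 * w * q) / 4 ≤ √(θ * w ^ 2 + θ ^ 2) := by
        refine Real.le_sqrt_of_sq_le ?_
        -- After `q² ≤ 3/2 θ` the coefficients are `63/4` and `63/8`, both below `16 = 4²`.
        have e4 : (2 * q ^ 2 + 3 / 2 * w * q) ^ 2 ≤ 7 * (q ^ 2) ^ 2 + 21 / 4 * (w ^ 2 * q ^ 2) := by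
          nlinarith [mul_nonneg (sq_nonneg q) (sq_nonneg (w - q))]
        have e5 : (q ^ 2) ^ 2 ≤ (3 / 2 * θ) ^ 2 := pow_le_pow_left₀ (sq_nonneg q) hLθ 2
        have e6 : w ^ 2 * q ^ 2 ≤ w ^ 2 * (3 / 2 * θ) :=
          mul_le_mul_of_nonneg_left hLθ (sq_nonneg w)
        nlinarith [mul_nonneg (sq_nonneg w) (by linarith : (0:ℝ) ≤ θ)]
      linarith

/-! ### Bernstein bounds for increments bounded by one -/

section Increments

variable {Ω : Type*} {m0 : MeasurableSpace Ω} {μ : Measure Ω} [IsProbabilityMeasure μ]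
  {ℱ : Filtration ℕ m0} {x h : ℕ → Ω → ℝ}

/-- One-sided time-uniform empirical Bernstein inequality for increments bounded by `1`. -/
theorem measure_exists_le_sum_le (hx : ∀ i, Measurable[ℱ (i + 1)] (x i))
    (hx0 : ∀ i, μ[x i | ℱ i] =ᵐ[μ] 0) (hx1 : ∀ i, ∀ᵐ ω ∂μ, |x i ω| ≤ 1)
    (hh : ∀ i, Measurable[ℱ i] (h i)) (hh1 : ∀ i, ∀ᵐ ω ∂μ, |h i ω| ≤ 1)
    {δ : ℝ} (hδ0 : 0 < δ) (hδ1 : δ < 1) (T : ℕ) :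
    μ {ω | ∃ t, 1 ≤ t ∧ t ≤ T ∧
        4 * √(timeUniformLog t δ * ∑ i ∈ Finset.range t, (x i ω - h i ω) ^ 2
          + timeUniformLog t δ ^ 2) ≤ ∑ i ∈ Finset.range t, x i ω} ≤ ENNReal.ofReal (δ / 2) := by
  set E : ℕ → Set Ω := fun k =>
    {ω | ∃ t ≤ T, Real.exp (stitchLog δ k) ≤ expProcess x h (stitchSlope δ k) t ω} with hE
  have hsub : {ω | ∃ t, 1 ≤ t ∧ t ≤ T ∧
        4 * √(timeUniformLog t δ * ∑ i ∈ Finset.range t, (x i ω - h i ω) ^ 2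
          + timeUniformLog t δ ^ 2) ≤ ∑ i ∈ Finset.range t, x i ω}
      ≤ᵐ[μ] ⋃ k ∈ Finset.range (T + 1), E k := by
    filter_upwards [ae_all_iff.2 hx1, ae_all_iff.2 hh1] with ω h1 h2
    rintro ⟨t, ht1, htT, hle⟩
    have hv : ∑ i ∈ Finset.range t, (x i ω - h i ω) ^ 2 ≤ 4 * t := by
      have := Finset.sum_le_card_nsmul (Finset.range t) (fun i => (x i ω - h i ω) ^ 2) 4 ?_
      · simpa [mul_comm] using this
      · intro i _
        have e1 := abs_le.1 (h1 i)
        have e2 := abs_le.1 (h2 i)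
        nlinarith
    obtain ⟨k, hkt, hk⟩ := exists_stitchLog_le hδ0 hδ1 ht1
      (Finset.sum_nonneg fun i _ => sq_nonneg _) hv hle
    refine Set.mem_biUnion (Finset.mem_coe.2 (Finset.mem_range.2 (by omega : k < T + 1))) ?_
    exact ⟨t, htT, Real.exp_le_exp.2 hk⟩
  refine (measure_mono_ae hsub).trans ((measure_biUnion_finset_le _ _).trans ?_)
  have hEk : ∀ k, μ (E k) ≤ ENNReal.ofReal (Real.exp (-stitchLog δ k)) := by
    intro k
    have := measure_exists_ge_le_of_supermartingale
      (supermartingale_expProcess hx hx0 hx1 hh hh1 (stitchSlope_nonneg δ k) (stitchSlope_lt δ k))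
      (fun n ω => Real.exp_nonneg _) (Real.exp_pos (stitchLog δ k)) T
    simpa [hE, expProcess, Real.exp_neg] using this
  refine (Finset.sum_le_sum fun k _ => hEk k).trans ?_
  rw [← ENNReal.ofReal_sum_of_nonneg fun k _ => Real.exp_nonneg _]
  exact ENNReal.ofReal_le_ofReal (sum_exp_neg_stitchLog_le hδ0 _)

/-- Two-sided time-uniform empirical Bernstein inequality for increments bounded by `1`. -/
theorem measure_exists_le_abs_sum_le (hx : ∀ i, Measurable[ℱ (i + 1)] (x i))
    (hx0 : ∀ i, μ[x i | ℱ i] =ᵐ[μ] 0) (hx1 : ∀ i, ∀ᵐ ω ∂μ, |x i ω| ≤ 1)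
    (hh : ∀ i, Measurable[ℱ i] (h i)) (hh1 : ∀ i, ∀ᵐ ω ∂μ, |h i ω| ≤ 1)
    {δ : ℝ} (hδ0 : 0 < δ) (hδ1 : δ < 1) (T : ℕ) :
    μ {ω | ∃ t, 1 ≤ t ∧ t ≤ T ∧
        4 * √(timeUniformLog t δ * ∑ i ∈ Finset.range t, (x i ω - h i ω) ^ 2
          + timeUniformLog t δ ^ 2) ≤ |∑ i ∈ Finset.range t, x i ω|} ≤ ENNReal.ofReal δ := by
  have h1 := measure_exists_le_sum_le hx hx0 hx1 hh hh1 hδ0 hδ1 T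
  have h2 := measure_exists_le_sum_le (μ := μ) (ℱ := ℱ) (x := fun i => -x i) (h := fun i => -h i)
    (fun i => (hx i).neg)
    (fun i => by
      filter_upwards [condExp_neg (μ := μ) (x i) (ℱ i), hx0 i] with ω e1 e2
      rw [e1, Pi.neg_apply, e2]
      simp)
    (fun i => by simpa using hx1 i) (fun i => (hh i).neg) (fun i => by simpa using hh1 i)
    hδ0 hδ1 T
  have h3 : ENNReal.ofReal δ = ENNReal.ofReal (δ / 2) + ENNReal.ofReal (δ / 2) := by
    rw [← ENNReal.ofReal_add (by positivity) (by positivity), add_halves]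
  rw [h3]
  refine (measure_mono ?_).trans ((measure_union_le _ _).trans (add_le_add h1 h2))
  rintro ω ⟨t, ht1, htT, hle⟩
  rcases le_abs.1 hle with hle | hle
  · exact Or.inl ⟨t, ht1, htT, hle⟩
  · refine Or.inr ⟨t, ht1, htT, ?_⟩
    have e : ∀ i, ((-x i) ω - (-h i) ω) ^ 2 = (x i ω - h i ω) ^ 2 := fun i => by
      simp only [Pi.neg_apply]
      ring
    simp only [e]
    simpa using hle

end Increments

/-! ### Truncation and the weighted bound -/

theorem timeUniformLog_nonneg {δ : ℝ} (hδ0 : 0 < δ) (hδ1 : δ < 1) {t : ℕ} (ht : 1 ≤ t) :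
    0 ≤ timeUniformLog t δ := by
  linarith [one_le_stitchLog hδ0 hδ1 0, stitchLog_zero_le hδ0 ht]

theorem timeUniformLog_mono {δ : ℝ} (hδ0 : 0 < δ) {s t : ℕ} (hs : 1 ≤ s) (hst : s ≤ t) :
    timeUniformLog s δ ≤ timeUniformLog t δ := by
  have hs1 : (1 : ℝ) ≤ s := by exact_mod_cast hs
  have hst1 : (s : ℝ) ≤ t := by exact_mod_cast hst
  have h1 : 0 < Real.log (6 * s) := Real.log_pos (by linarith)
  have h2 : Real.log (6 * s) ≤ Real.log (6 * t) := Real.log_le_log (by linarith) (by linarith)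
  exact Real.log_le_log (by positivity) (div_le_div_of_nonneg_right (by linarith) hδ0.le)

theorem mainTheorem6 {Ω : Type*} {m0 : MeasurableSpace Ω} (μ : Measure Ω) [IsProbabilityMeasure μ]
    (ℱ : Filtration ℕ m0) (C X Xhat : ℕ → Ω → ℝ)
    (hC : ∀ t, Measurable[ℱ t] (C (t + 1)))
    (hX : IsMartingaleDifference X ℱ μ)
    (hXC : ∀ t, 1 ≤ t → ∀ᵐ ω ∂μ, |X t ω| ≤ C t ω)
    (hXhat : ∀ t, Measurable[ℱ t] (Xhat (t + 1)))
    (hXhatC : ∀ t, 1 ≤ t → ∀ᵐ ω ∂μ, |Xhat t ω| ≤ C t ω)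
    (T : ℕ) (δ : ℝ) (hδ0 : 0 < δ) (hδ1 : δ < 1) (c : ℝ) (hc : 0 < c) :
    μ {ω | ∃ t, 1 ≤ t ∧ t ≤ T ∧ ∃ y ∈ nonnegNondecSeq, 0 < y t ∧
        8 * y t * Real.sqrt (timeUniformLog t δ * ∑ i ∈ Finset.Icc 1 t, (X i ω - Xhat i ω) ^ 2
            + c ^ 2 * timeUniformLog t δ ^ 2)
          ≤ |∑ i ∈ Finset.Icc 1 t, y i * X i ω|}
      ≤ ENNReal.ofReal δ + μ {ω | ∃ t, 1 ≤ t ∧ t ≤ T ∧ c < C t ω} := by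
  -- Indices shift by one: `x i` comes from `X (i + 1)`, and `A i` is already `ℱ i`-measurable.
  set A : ℕ → Set Ω := fun i => {ω | C (i + 1) ω ≤ c} with hA
  have hAm : ∀ i, MeasurableSet[ℱ i] (A i) := fun i => hC i measurableSet_Iic
  set x : ℕ → Ω → ℝ := fun i => c⁻¹ • (A i).indicator (X (i + 1)) with hxdef
  set h : ℕ → Ω → ℝ := fun i => c⁻¹ • (A i).indicator (Xhat (i + 1)) with hhdef
  have hx : ∀ i, Measurable[ℱ (i + 1)] (x i) := fun i =>
    ((hX.measurable i).indicator (ℱ.mono (Nat.le_succ i) _ (hAm i))).const_smul _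
  have hh : ∀ i, Measurable[ℱ i] (h i) := fun i => ((hXhat i).indicator (hAm i)).const_smul _
  have hx0 : ∀ i, μ[x i | ℱ i] =ᵐ[μ] 0 := by
    intro i
    have e1 := condExp_smul (μ := μ) c⁻¹ ((A i).indicator (X (i + 1))) (ℱ i)
    have e2 := condExp_indicator (m := ℱ i) (hX.integrable i) (hAm i)
    filter_upwards [e1, e2, hX.condExp_eq_zero i] with ω h1 h2 h3
    rw [hxdef, h1, Pi.smul_apply, h2]
    by_cases hω : ω ∈ A i <;> simp [hω, h3]
  have hbound : ∀ Y : ℕ → Ω → ℝ, (∀ t, 1 ≤ t → ∀ᵐ ω ∂μ, |Y t ω| ≤ C t ω) →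
      ∀ i, ∀ᵐ ω ∂μ, |(c⁻¹ • (A i).indicator (Y (i + 1))) ω| ≤ 1 := by
    intro Y hY i
    filter_upwards [hY (i + 1) (by omega)] with ω hω
    rw [Pi.smul_apply, smul_eq_mul, abs_mul, abs_of_pos (inv_pos.2 hc)]
    by_cases hωA : ω ∈ A i
    · rw [Set.indicator_of_mem hωA, inv_mul_le_one₀ hc]
      exact hω.trans hωA
    · simp [Set.indicator_of_notMem hωA]
  have hmain := measure_exists_le_abs_sum_le hx hx0 (hbound X hXC) hh (hbound Xhat hXhatC)
    hδ0 hδ1 T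
  refine (measure_mono ?_).trans ((measure_union_le _ _).trans (add_le_add hmain le_rfl))
  rintro ω ⟨t, ht1, htT, y, hy, hyt, hle⟩
  by_cases hCω : ∃ t, 1 ≤ t ∧ t ≤ T ∧ c < C t ω
  · exact Or.inr hCω
  push Not at hCω
  refine Or.inl ?_
  obtain ⟨s, hs1, hst, hs⟩ := exists_le_abs_sum_of_nonnegNondecSeq (x := fun i => X i ω)
    (B := 4 * √(timeUniformLog t δ * ∑ i ∈ Finset.Icc 1 t, (X i ω - Xhat i ω) ^ 2
            + c ^ 2 * timeUniformLog t δ ^ 2)) hy ht1 hyt (by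
      refine le_trans (le_of_eq ?_) hle
      ring)
  refine ⟨s, hs1, hst.trans htT, ?_⟩
  have hmem : ∀ i ∈ Finset.range s, ω ∈ A i := fun i hi =>
    hCω (i + 1) (by omega) (by have := Finset.mem_range.1 hi; omega)
  have hshift : ∀ f : ℕ → ℝ, ∑ i ∈ Finset.range s, f (i + 1) = ∑ i ∈ Finset.Icc 1 s, f i := by
    intro f
    rw [Finset.range_eq_Ico, Finset.sum_Ico_add' f 0 s 1]
    rfl
  have e1 : ∑ i ∈ Finset.range s, x i ω = c⁻¹ * ∑ i ∈ Finset.Icc 1 s, X i ω := by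
    rw [← hshift, Finset.mul_sum]
    refine Finset.sum_congr rfl fun i hi => ?_
    simp [hxdef, Set.indicator_of_mem (hmem i hi)]
  have e2 : ∑ i ∈ Finset.range s, (x i ω - h i ω) ^ 2
      = (c ^ 2)⁻¹ * ∑ i ∈ Finset.Icc 1 s, (X i ω - Xhat i ω) ^ 2 := by
    rw [← hshift (fun i => (X i ω - Xhat i ω) ^ 2), Finset.mul_sum]
    refine Finset.sum_congr rfl fun i hi => ?_
    simp only [hxdef, hhdef, Pi.smul_apply, Set.indicator_of_mem (hmem i hi), smul_eq_mul]
    field_simp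
  rw [e1, e2, abs_mul, abs_of_pos (inv_pos.2 hc), inv_mul_eq_div c, le_div_iff₀ hc]
  refine le_trans ?_ hs
  have hθs := timeUniformLog_nonneg hδ0 hδ1 hs1
  have hθ := timeUniformLog_mono hδ0 hs1 hst
  have hV : ∑ i ∈ Finset.Icc 1 s, (X i ω - Xhat i ω) ^ 2
      ≤ ∑ i ∈ Finset.Icc 1 t, (X i ω - Xhat i ω) ^ 2 :=
    Finset.sum_le_sum_of_subset_of_nonneg (Finset.Icc_subset_Icc le_rfl hst)
      fun i _ _ => sq_nonneg _
  have hV0 : 0 ≤ ∑ i ∈ Finset.Icc 1 s, (X i ω - Xhat i ω) ^ 2 :=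
    Finset.sum_nonneg fun i _ => sq_nonneg _
  rw [mul_assoc]
  refine mul_le_mul_of_nonneg_left ?_ (by norm_num)
  nth_rewrite 2 [← Real.sqrt_sq hc.le]
  rw [← Real.sqrt_mul' _ (sq_nonneg c)]
  refine Real.sqrt_le_sqrt ?_
  have e3 : (timeUniformLog s δ * ((c ^ 2)⁻¹ * ∑ i ∈ Finset.Icc 1 s, (X i ω - Xhat i ω) ^ 2)
      + timeUniformLog s δ ^ 2) * c ^ 2
      = timeUniformLog s δ * ∑ i ∈ Finset.Icc 1 s, (X i ω - Xhat i ω) ^ 2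
        + c ^ 2 * timeUniformLog s δ ^ 2 := by
    field_simp
  rw [e3]
  exact add_le_add (mul_le_mul hθ hV hV0 (hθs.trans hθ))
    (mul_le_mul_of_nonneg_left (pow_le_pow_left₀ hθs hθ 2) (sq_nonneg c))
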